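/- Theorem 2.3. Let $X_1,X_2,\dots$ be i.i.d. real random variables with common law $P$, and let $X$ have law $P$. Let $F,U:\mathbb R\to\mathbb R$ be measurable functions such that $F(X)$ and $U(X)$ have finite second moments, put $\mu=E[F(X)]$ and $\nu=E[U(X)]$, and suppose that $m(\beta)=\operatorname{ess\,sup}[F(X)-\beta U(X)]<\infty$ for every $\beta>0$. Write $S_n=\sum_{i=1}^nF(X_i)$, $T_n=\sum_{i=1}^nU(X_i)$ and, for $\theta_1,\theta_2\ge 0$ and $\varepsilon,u\in\mathbb R$, $$\Lambda_+(\theta_1,\theta_2)=\log E\big[e^{\theta_1F(X)-\theta_2U(X)}\big]\in(-\infty,\infty],\qquad \Lambda_+^*(\varepsilon,u)=\sup_{\theta_1,\theta_2\ge 0}\{\theta_1(\mu+\varepsilon)-\theta_2(\nu+u)-\Lambda_+(\theta_1,\theta_2)\}.$$ Let $D=\{(\varepsilon,u)\in\mathbb R^2:\Lambda_+^*(\varepsilon,u)<\infty\}$. Let $H(E\|P)=\inf_{Q\in E}H(Q\|P)$ (equal to $+\infty$ if $E$ is empty), where $E=E(\varepsilon,u)$ is the set of all probability measures $Q$ on $\mathbb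 R$ for which $F$ and $U$ are $Q$-integrable with $\int F\,dQ-\mu>\varepsilon$ and $\int U\,dQ-\nu<u$, and where $H(Q\|P)=\int\log\frac{dQ}{dP}\,dQ$ if $Q\ll P$ and $H(Q\|P)=\infty$ otherwise. Then for all $\varepsilon,u>0$, with $\log 0=-\infty$ and limits taken in $[-\infty,\infty]$, $$\lim_{n\to\infty}\frac1n\log\Pr\{S_n-n\mu>n\varepsilon,\ T_n-n\nu<nu\}=-H(E\|P).$$ Moreover, for all $\varepsilon,u>0$ such that $(\varepsilon,u)\notin D\setminus\operatorname{int}D$ (that is, $(\varepsilon,u)$ is not a boundary point of $D$ at which $\Lambda_+^*$ is finite), $$\lim_{n\to\infty}\frac1n\log\Pr\{S_n-n\mu>n\varepsilon,\ T_n-n\nu<nu\}=-\Lambda_+^*(\varepsilon,u)\qquad\text{and}\qquad \Lambda_+^*(\varepsilon,u)=H(E\|P).$$ -/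

import Mathlib

open MeasureTheory ProbabilityTheory Filter Topology

namespace Screened

noncomputable section

/-- `m(β) = ess sup [F(X) - β U(X)]`, as an extended real number. -/
def essBound (P : Measure ℝ) (F U : ℝ → ℝ) (β : ℝ) : EReal :=
  essSup (fun x => ((F x - β * U x : ℝ) : EReal)) P

/-- `Λ₊(θ₁, θ₂) = log E[exp(θ₁ F(X) - θ₂ U(X))]`, with value `+∞` where the expectation is
infinite. -/
def logMgf (P : Measure ℝ) (F U : ℝ → ℝ) (θ₁ θ₂ : ℝ) : EReal :=
  ENNReal.log (∫⁻ x, ENNReal.ofReal (Real.exp (θ₁ * F x - θ₂ * U x)) ∂P)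

/-- `Λ₊*(ε, u) = sup_{θ₁, θ₂ ≥ 0} {θ₁ (μ + ε) - θ₂ (ν + u) - Λ₊(θ₁, θ₂)}`, where `μ` and `ν` are
the means of `F` and `U` under `P`. -/
def rate (P : Measure ℝ) (F U : ℝ → ℝ) (ε u : ℝ) : EReal :=
  ⨆ (θ₁ : ℝ) (_ : 0 ≤ θ₁) (θ₂ : ℝ) (_ : 0 ≤ θ₂),
    ((θ₁ * ((∫ x, F x ∂P) + ε) - θ₂ * ((∫ x, U x ∂P) + u) : ℝ) : EReal) - logMgf P F U θ₁ θ₂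

/-- The effective domain `{(ε, u) : Λ₊*(ε, u) < ∞}` of the rate function. -/
def rateDomain (P : Measure ℝ) (F U : ℝ → ℝ) : Set (ℝ × ℝ) :=
  {p | rate P F U p.1 p.2 < ⊤}

/-- The set `E` of all probability measures `Q` on `ℝ` such that `∫ F dQ - μ > ε` and
`∫ U dQ - ν < u`; both integrals are required to exist. -/
def entropySet (P : Measure ℝ) (F U : ℝ → ℝ) (ε u : ℝ) : Set (Measure ℝ) :=
  {Q | IsProbabilityMeasure Q ∧ Integrable F Q ∧ Integrable U Q ∧
    ε < (∫ x, F x ∂Q) - ∫ x, F x ∂P ∧ (∫ x, U x ∂Q) - ∫ x, U x ∂P < u}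

/-- `H(E‖P) = inf {H(Q‖P) : Q ∈ E}`, equal to `+∞` if `E` is empty. -/
def entropyRate (P : Measure ℝ) (F U : ℝ → ℝ) (ε u : ℝ) : ENNReal :=
  ⨅ Q ∈ entropySet P F U ε u, InformationTheory.klDiv Q P

/-- The event `{S_n - n μ > n ε, T_n - n ν < n u}`, with `S_n` and `T_n` the `n`-th partial sums
of `F(X_i)` and `U(X_i)`, and `μ`, `ν` the means of `F`, `U` under `P`. -/
def errorEvent {Ω : Type*} (P : Measure ℝ) (F U : ℝ → ℝ) (X : ℕ → Ω → ℝ) (ε u : ℝ) (n : ℕ) :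
    Set Ω :=
  {ω | (∑ i ∈ Finset.range n, F (X i ω)) - n * (∫ x, F x ∂P) > n * ε ∧
    (∑ i ∈ Finset.range n, U (X i ω)) - n * (∫ x, U x ∂P) < n * u}

end

end Screened

/-! Write `A_n` for the event in the product `P^n` and `p_n` for its probability.

The limit rests on two changes of measure. Lower bound: for `Q ∈ E` of finite entropy and `h >
H(Q‖P)`, the strong law under `Q` gives `A_n` and `log dQ^n/dP^n < nh` with probability tending to
1, so `1/2 ≤ e^{nh} p_n` eventually (`eventually_half_le_exp_mul_prodEvent`). Upper bound: condition
`P^n` on `A_n` and average the marginals. The average `Q` lies in `E` because its means are those of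
`S_n/n` and `T_n/n` given `A_n`, and Jensen's inequality gives `n H(Q‖P) ≤ -log p_n`
(`exists_mem_entropySet_mul_klDiv_le`). Hence `p_n ≤ e^{-n H(E‖P)}` for every `n ≥ 1` with no
compactness argument.

The identity `Λ₊* = H(E‖P)` is convex duality. The Gibbs inequality gives `≤`. For `≥`, a point `(ε,
u, c)` with `c < H(E‖P)` is separated from the open convex set of triples reached by bounded
densities. A non-vertical hyperplane supplies multipliers `θ₁, θ₂ ≥ 0` certifying `c ≤ Λ₊*`, because
bounded densities already determine `Λ₊`. A vertical one forces `Λ₊* = ∞` at points arbitrarily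
close to `(ε, u)`, which is impossible in the interior of `D`; outside `D` there is nothing to
prove. -/

open scoped ENNReal

namespace Screened

/-! ### Product measures and the lower bound by change of measure -/

lemma pi_withDensity {α : Type*} [MeasurableSpace α] {n : ℕ} (P : Measure α)
    [IsProbabilityMeasure P] {f : α → ℝ≥0∞} (hf : Measurable f)
    [IsProbabilityMeasure (P.withDensity f)] :
    Measure.pi (fun _ : Fin n => P.withDensity f) =
      (Measure.pi fun _ : Fin n => P).withDensity (fun x => ∏ i, f (x i)) := by
  refine Measure.pi_eq fun s hs => ?_
  rw [withDensity_apply _ (MeasurableSet.univ_pi hs),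
    ← lintegral_indicator (MeasurableSet.univ_pi hs)]
  have h1 : (Set.univ.pi s).indicator (fun x : Fin n → α => ∏ i, f (x i)) =
      fun x => ∏ i, (s i).indicator f (x i) := by
    ext x
    by_cases hx : ∀ i, x i ∈ s i
    · rw [Set.indicator_of_mem (by simpa using hx)]
      exact Finset.prod_congr rfl fun i _ => (Set.indicator_of_mem (hx i) f).symm
    · rw [Set.indicator_of_notMem (by simpa using hx)]
      push Not at hx
      obtain ⟨i, hi⟩ := hx
      exact (Finset.prod_eq_zero (Finset.mem_univ i) (Set.indicator_of_notMem hi f)).symm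
  have hind : iIndepFun (fun i (x : Fin n → α) => (s i).indicator f (x i))
      (Measure.pi fun _ : Fin n => P) :=
    iIndepFun_pi (X := fun i => (s i).indicator f)
      fun i => (hf.indicator (hs i)).aemeasurable
  rw [h1, lintegral_prod_eq_prod_lintegral_of_indepFun Finset.univ
    (fun i (x : Fin n → α) => (s i).indicator f (x i)) hind
    (fun i => (hf.indicator (hs i)).comp (measurable_pi_apply i))]
  refine Finset.prod_congr rfl fun i _ => ?_
  rw [withDensity_apply _ (hs i), ← lintegral_indicator (hs i),
    ← (measurePreserving_eval (fun _ : Fin n => P) i).lintegral_comp (hf.indicator (hs i))]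

lemma hasLaw_pi_of_iIndepFun {Ω α : Type*} [MeasurableSpace Ω] [MeasurableSpace α]
    {Pr : Measure Ω} [IsProbabilityMeasure Pr] {P : Measure α} [IsProbabilityMeasure P]
    {X : ℕ → Ω → α} (hlaw : ∀ i, HasLaw (X i) P Pr) (hindep : iIndepFun X Pr) (n : ℕ) :
    HasLaw (fun ω (i : Fin n) => X i ω) (Measure.pi fun _ : Fin n => P) Pr :=
  (hindep.precomp Fin.val_injective).hasLaw_pi fun i => hlaw i

/-- The strong law, stated on the infinite product so that all `n` share one probability space. -/
lemma ae_eventually_mul_lt_sum {α : Type*} [MeasurableSpace α] {Q : Measure α}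
    [IsProbabilityMeasure Q] {f : α → ℝ} (hf : Measurable f) (hfi : Integrable f Q) {a : ℝ}
    (ha : a < ∫ x, f x ∂Q) :
    ∀ᵐ ω ∂Measure.infinitePi (fun _ : ℕ => Q),
      ∀ᶠ n : ℕ in atTop, n * a < ∑ i : Fin n, f (ω i) := by
  have hp : ∀ i : ℕ, MeasurePreserving (Function.eval i)
      (Measure.infinitePi fun _ : ℕ => Q) Q := fun i => measurePreserving_eval_infinitePi _ i
  have hmean : ∫ ω, f (ω 0) ∂(Measure.infinitePi fun _ : ℕ => Q) = ∫ x, f x ∂Q := by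
    conv_rhs => rw [← (hp 0).map_eq,
      integral_map (hp 0).measurable.aemeasurable hf.aestronglyMeasurable]
  have hind : iIndepFun (fun (i : ℕ) (ω : ℕ → α) => f (ω i))
      (Measure.infinitePi fun _ : ℕ => Q) :=
    iIndepFun_infinitePi (X := fun _ => f) fun _ => hf
  have hslln := strong_law_ae_real (μ := Measure.infinitePi fun _ : ℕ => Q)
    (fun i ω => f (ω i)) ((hp 0).integrable_comp_of_integrable hfi)
    (fun i j hij => hind.indepFun hij)
    (fun i => ((hp i).hasLaw.identDistrib (hp 0).hasLaw).comp hf)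
  filter_upwards [hslln] with ω hω
  rw [hmean] at hω
  filter_upwards [hω.eventually_const_lt ha, eventually_gt_atTop 0] with n hn hn0
  rw [lt_div_iff₀ (by exact_mod_cast hn0)] at hn
  rw [Fin.sum_univ_eq_sum_range (fun i => f (ω i))]
  linarith

/-- The event `{S_n - n μ > n ε, T_n - n ν < n u}` as a subset of the `n`-fold product. -/
def prodEvent (P : Measure ℝ) (F U : ℝ → ℝ) (ε u : ℝ) (n : ℕ) : Set (Fin n → ℝ) :=
  {x | n * ((∫ x, F x ∂P) + ε) < ∑ i, F (x i) ∧ ∑ i, U (x i) < n * ((∫ x, U x ∂P) + u)}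

section

variable {P : Measure ℝ} {F U : ℝ → ℝ} {ε u : ℝ}

lemma measurableSet_prodEvent (hF : Measurable F) (hU : Measurable U) (n : ℕ) :
    MeasurableSet (prodEvent P F U ε u n) := by
  have h1 : Measurable fun x : Fin n → ℝ => ∑ i, F (x i) := by fun_prop
  have h2 : Measurable fun x : Fin n → ℝ => ∑ i, U (x i) := by fun_prop
  exact (measurableSet_lt measurable_const h1).inter (measurableSet_lt h2 measurable_const)

lemma measure_errorEvent_eq {Ω : Type*} [MeasurableSpace Ω] {Pr : Measure Ω}
    [IsProbabilityMeasure Pr] [IsProbabilityMeasure P] {X : ℕ → Ω → ℝ}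
    (hlaw : ∀ i, HasLaw (X i) P Pr) (hindep : iIndepFun X Pr)
    (hF : Measurable F) (hU : Measurable U) (n : ℕ) :
    Pr (errorEvent P F U X ε u n) =
      (Measure.pi fun _ : Fin n => P) (prodEvent P F U ε u n) := by
  rw [← (hasLaw_pi_of_iIndepFun hlaw hindep n).map_eq, Measure.map_apply_of_aemeasurable
    (hasLaw_pi_of_iIndepFun hlaw hindep n).aemeasurable (measurableSet_prodEvent hF hU n)]
  congr 1
  ext ω
  simp only [errorEvent, prodEvent, Set.mem_ofPred_eq, Set.mem_preimage,
    Fin.sum_univ_eq_sum_range (fun i => F (X i ω)), Fin.sum_univ_eq_sum_range (fun i => U (X i ω)),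
    mul_add]
  constructor <;> rintro ⟨h1, h2⟩ <;> constructor <;> linarith

lemma eventually_half_le_exp_mul_prodEvent [IsProbabilityMeasure P]
    (hF : Measurable F) (hU : Measurable U) {Q : Measure ℝ} (hQ : Q ∈ entropySet P F U ε u)
    (hkl : InformationTheory.klDiv Q P ≠ ⊤) {h : ℝ}
    (hh : (InformationTheory.klDiv Q P).toReal < h) :
    ∀ᶠ n : ℕ in atTop, 2⁻¹ ≤ ENNReal.ofReal (Real.exp (n * h)) *
      (Measure.pi fun _ : Fin n => P) (prodEvent P F U ε u n) := by
  obtain ⟨hQp, hFQ, hUQ, hFε, hUu⟩ := hQ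
  obtain ⟨hac, hllr⟩ := InformationTheory.klDiv_ne_top_iff.1 hkl
  rw [InformationTheory.toReal_klDiv_of_measure_eq hac (by simp)] at hh
  have hllm : Measurable (llr Q P) := measurable_llr Q P
  -- Three strong laws under `Q`; the upper bounds on the sums of `U` and of the log-likelihood
  -- ratio come from the negated functions.
  have hev := ae_eventually_mul_lt_sum hF hFQ (a := (∫ x, F x ∂P) + ε) (by linarith)
  have hevU := ae_eventually_mul_lt_sum hU.neg hUQ.neg (a := -((∫ x, U x ∂P) + u))
    (by simp only [Pi.neg_apply, integral_neg]; linarith)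
  have hevl := ae_eventually_mul_lt_sum hllm.neg hllr.neg (a := -h)
    (by simp only [Pi.neg_apply, integral_neg]; linarith)
  let C : (n : ℕ) → Set (Fin n → ℝ) := fun n =>
    prodEvent P F U ε u n ∩ {x | ∑ i, llr Q P (x i) < n * h}
  have hC : ∀ n, MeasurableSet (C n) := fun n => (measurableSet_prodEvent hF hU n).inter
    (measurableSet_lt (by fun_prop) measurable_const)
  have hlaw : ∀ n : ℕ, HasLaw (fun (ω : ℕ → ℝ) (i : Fin n) => ω i)
      (Measure.pi fun _ : Fin n => Q) (Measure.infinitePi fun _ : ℕ => Q) := fun n =>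
    hasLaw_pi_of_iIndepFun (X := fun (i : ℕ) (ω : ℕ → ℝ) => ω i)
      (fun i => (measurePreserving_eval_infinitePi (fun _ : ℕ => Q) i).hasLaw)
      (iIndepFun_infinitePi (X := fun _ x => x) fun _ => measurable_id) n
  have hmeas : ∀ n : ℕ, MeasurableSet ((fun (ω : ℕ → ℝ) (i : Fin n) => ω i) ⁻¹' C n) :=
    fun n => (hC n).preimage (by fun_prop)
  have hlim : Tendsto (fun n : ℕ => (Measure.pi fun _ : Fin n => Q) (C n)) atTop (𝓝 1) := by
    have := tendsto_measure_of_ae_tendsto_indicator (μ := Measure.infinitePi fun _ : ℕ => Q)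
      (L := atTop) MeasurableSet.univ hmeas MeasurableSet.univ (by simp)
      (Eventually.of_forall fun _ => Set.subset_univ _) (by
        filter_upwards [hev, hevU, hevl] with ω h1 h2 h3
        filter_upwards [h1, h2, h3] with n h1 h2 h3
        simp only [Pi.neg_apply, Finset.sum_neg_distrib, mul_neg, neg_lt_neg_iff] at h2 h3
        exact iff_of_true ⟨⟨h1, h2⟩, h3⟩ trivial)
    rw [measure_univ] at this
    refine this.congr fun n => ?_
    rw [← (hlaw n).map_eq, Measure.map_apply_of_aemeasurable (hlaw n).aemeasurable (hC n)]
  filter_upwards [hlim.eventually_const_le (u := 2⁻¹) (by simp)] with n hn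
  refine hn.trans ?_
  have hQeq : Q = P.withDensity fun x => ENNReal.ofReal (Q.rnDeriv P x).toReal := by
    conv_lhs => rw [← Measure.withDensity_rnDeriv_eq Q P hac]
    refine withDensity_congr_ae ?_
    filter_upwards [Measure.rnDeriv_ne_top Q P] with x hx
    rw [ENNReal.ofReal_toReal hx]
  have : IsProbabilityMeasure
      (P.withDensity fun x => ENNReal.ofReal (Q.rnDeriv P x).toReal) := hQeq ▸ hQp
  have hpi : (Measure.pi fun _ : Fin n => Q) = (Measure.pi fun _ : Fin n => P).withDensity
      (fun x => ∏ i, ENNReal.ofReal (Q.rnDeriv P (x i)).toReal) := by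
    rw [← pi_withDensity (f := fun x => ENNReal.ofReal (Q.rnDeriv P x).toReal) P (by fun_prop)]
    congr
    exact funext fun _ => hQeq
  calc (Measure.pi fun _ : Fin n => Q) (C n)
      = ∫⁻ x in C n, ∏ i, ENNReal.ofReal (Q.rnDeriv P (x i)).toReal
          ∂(Measure.pi fun _ : Fin n => P) := by rw [hpi, withDensity_apply _ (hC n)]
    _ ≤ ∫⁻ _ in C n, ENNReal.ofReal (Real.exp (n * h)) ∂(Measure.pi fun _ : Fin n => P) := by
        refine setLIntegral_mono measurable_const fun x hx => ?_
        rw [← ENNReal.ofReal_prod_of_nonneg fun _ _ => ENNReal.toReal_nonneg]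
        refine ENNReal.ofReal_le_ofReal ?_
        -- Only an inequality: where the density vanishes, `llr` takes the value `log 0 = 0`, whose
        -- exponential still dominates.
        calc ∏ i, (Q.rnDeriv P (x i)).toReal ≤ ∏ i, Real.exp (llr Q P (x i)) :=
              Finset.prod_le_prod (fun _ _ => ENNReal.toReal_nonneg)
                fun i _ => Real.le_exp_log _
          _ = Real.exp (∑ i, llr Q P (x i)) := (Real.exp_sum _ _).symm
          _ ≤ Real.exp (n * h) := Real.exp_le_exp.2 hx.2.le
    _ ≤ _ := by
        rw [setLIntegral_const]
        gcongr
        exact Set.inter_subset_left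

end

/-! ### The upper bound by conditioning and averaging marginals -/

/-- The average of the one-dimensional marginals of a measure on a finite power. -/
noncomputable def avgMarginal {α : Type*} [MeasurableSpace α] {n : ℕ}
    (ρ : Measure (Fin n → α)) : Measure α :=
  (n : ℝ≥0∞)⁻¹ • ∑ i, ρ.map (Function.eval i)

section

variable {α : Type*} [MeasurableSpace α] {n : ℕ} {ρ : Measure (Fin n → α)} {P : Measure α}

lemma isProbabilityMeasure_avgMarginal [IsProbabilityMeasure ρ] (hn : n ≠ 0) :
    IsProbabilityMeasure (avgMarginal ρ) := by
  constructor
  have : ∀ i : Fin n, ρ.map (Function.eval i) Set.univ = 1 := fun i => by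
    rw [Measure.map_apply (measurable_pi_apply i) MeasurableSet.univ, Set.preimage_univ,
      measure_univ]
  simp only [avgMarginal, Measure.smul_apply, Measure.finsetSum_apply, this, Finset.sum_const,
    Finset.card_univ, Fintype.card_fin, smul_eq_mul, nsmul_eq_mul, mul_one]
  exact ENNReal.inv_mul_cancel (by exact_mod_cast hn) (by simp)

lemma map_eval_le_smul [IsProbabilityMeasure P] {c : ℝ≥0∞}
    (hρ : ρ ≤ c • Measure.pi fun _ : Fin n => P) (i : Fin n) :
    ρ.map (Function.eval i) ≤ c • P := by
  refine (Measure.map_mono hρ (measurable_pi_apply i)).trans ?_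
  rw [Measure.map_smul, (measurePreserving_eval (fun _ : Fin n => P) i).map_eq]

lemma avgMarginal_le_smul [IsProbabilityMeasure P] {c : ℝ≥0∞} (hn : n ≠ 0)
    (hρ : ρ ≤ c • Measure.pi fun _ : Fin n => P) : avgMarginal ρ ≤ c • P := by
  refine Measure.le_iff.2 fun s _ => ?_
  simp only [avgMarginal, Measure.smul_apply, Measure.finsetSum_apply, smul_eq_mul]
  calc (n : ℝ≥0∞)⁻¹ * ∑ i : Fin n, ρ.map (Function.eval i) s
      ≤ (n : ℝ≥0∞)⁻¹ * ∑ _i : Fin n, c * P s := by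
        gcongr with i
        exact map_eval_le_smul hρ i s
    _ = c * P s := by
        rw [Finset.sum_const, Finset.card_univ, Fintype.card_fin, nsmul_eq_mul, ← mul_assoc,
          ENNReal.inv_mul_cancel (by exact_mod_cast hn) (by simp), one_mul]

lemma map_eval_absolutelyContinuous_avgMarginal (i : Fin n) :
    ρ.map (Function.eval i) ≪ avgMarginal ρ := by
  refine Measure.AbsolutelyContinuous.mk fun s _ hs => ?_
  simp only [avgMarginal, Measure.smul_apply, Measure.finsetSum_apply, smul_eq_mul,
    mul_eq_zero, ENNReal.inv_eq_zero, ENNReal.natCast_ne_top, false_or,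
    Finset.sum_eq_zero_iff] at hs
  exact hs i (Finset.mem_univ i)

lemma integrable_comp_eval [IsProbabilityMeasure P] {c : ℝ≥0∞} (hc : c ≠ ∞)
    (hρ : ρ ≤ c • Measure.pi fun _ : Fin n => P) {g : α → ℝ} (hg : Integrable g P) (i : Fin n) :
    Integrable (fun x => g (x i)) ρ :=
  ((measurePreserving_eval (fun _ : Fin n => P) i).integrable_comp_of_integrable hg).of_measure_le_smul
    hc hρ

lemma integrable_eval_of_avgMarginal {g : α → ℝ} (hg : Integrable g (avgMarginal ρ)) (i : Fin n) :
    Integrable (fun x => g (x i)) ρ := by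
  have hn : n ≠ 0 := fun h => by subst h; exact i.elim0
  have h1 : Integrable g (∑ i, ρ.map (Function.eval i)) := by
    rwa [avgMarginal, integrable_smul_measure (by simp) (by simpa using hn)] at hg
  exact (integrable_finsetSum_measure.1 h1 i (Finset.mem_univ i)).comp_measurable
    (measurable_pi_apply i)

lemma mul_integral_avgMarginal (hn : n ≠ 0) {g : α → ℝ} (hgm : Measurable g)
    (hg : ∀ i, Integrable (fun x => g (x i)) ρ) :
    n * ∫ x, g x ∂avgMarginal ρ = ∫ x, ∑ i, g (x i) ∂ρ := by
  have hm : ∀ i : Fin n, Integrable g (ρ.map (Function.eval i)) := fun i =>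
    (integrable_map_measure hgm.aestronglyMeasurable (measurable_pi_apply i).aemeasurable).2 (hg i)
  rw [avgMarginal, integral_smul_measure, integral_finsetSum_measure fun i _ => hm i,
    integral_finsetSum _ fun i _ => hg i]
  simp only [ENNReal.toReal_inv, ENNReal.toReal_natCast, smul_eq_mul]
  rw [← mul_assoc, mul_inv_cancel₀ (by exact_mod_cast hn), one_mul]
  exact Finset.sum_congr rfl fun i _ =>
    integral_map (measurable_pi_apply i).aemeasurable hgm.aestronglyMeasurable

/-- The density takes values in `[0, c]`, where `t log t` is bounded. -/
lemma integrable_llr_of_le_smul {Q : Measure α} [IsProbabilityMeasure P] [IsProbabilityMeasure Q]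
    {c : ℝ≥0∞} (hc : c ≠ ∞) (hQ : Q ≤ c • P) : Integrable (llr Q P) Q := by
  have hac : Q ≪ P := (Measure.absolutelyContinuous_of_le hQ).trans Measure.smul_absolutelyContinuous
  rw [← integrable_rnDeriv_mul_log_iff hac]
  have hle : Q.rnDeriv P ≤ᵐ[P] fun _ => c := by
    refine ae_le_of_forall_setLIntegral_le_of_sigmaFinite (Measure.measurable_rnDeriv Q P) ?_
    intro s hs _
    rw [Measure.setLIntegral_rnDeriv hac, setLIntegral_const]
    exact hQ s
  obtain ⟨B, hB⟩ := (isCompact_Icc (a := (0 : ℝ)) (b := c.toReal)).exists_bound_of_continuousOn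
    Real.continuous_mul_log.continuousOn
  refine Integrable.of_bound (Measurable.aestronglyMeasurable (by fun_prop)) B ?_
  filter_upwards [hle] with x hx
  exact hB _ ⟨ENNReal.toReal_nonneg, ENNReal.toReal_mono hc hx⟩

/-- Superadditivity of the relative entropy with respect to a product measure, for a law with
bounded density. -/
lemma mul_integral_llr_avgMarginal_le [IsProbabilityMeasure P] [IsProbabilityMeasure ρ]
    {c : ℝ≥0∞} (hc : c ≠ ∞) (hn : n ≠ 0) (hρ : ρ ≤ c • Measure.pi fun _ : Fin n => P) :
    n * ∫ x, llr (avgMarginal ρ) P x ∂avgMarginal ρ ≤ Real.log c.toReal := by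
  have hQp := isProbabilityMeasure_avgMarginal (ρ := ρ) hn
  have hQ := avgMarginal_le_smul hn hρ
  have hc0 : c ≠ 0 := by
    rintro rfl
    have := hρ Set.univ
    simp at this
  have hcpos : 0 < c.toReal := ENNReal.toReal_pos hc0 hc
  generalize hQdef : avgMarginal ρ = Q at *
  have hac : Q ≪ P := (Measure.absolutelyContinuous_of_le hQ).trans Measure.smul_absolutelyContinuous
  have hint := integrable_llr_of_le_smul hc hQ
  have hinti : ∀ i : Fin n, Integrable (fun x => llr Q P (x i)) ρ :=
    fun i => integrable_eval_of_avgMarginal (hQdef ▸ hint) i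
  have hmeq := mul_integral_avgMarginal (ρ := ρ) hn (measurable_llr Q P) hinti
  rw [hQdef] at hmeq
  rw [hmeq]
  -- Positivity makes `exp (llr)` equal to the density; at a zero of the density it would be 1, too
  -- large for the bound below.
  have hpos : ∀ᵐ x ∂ρ, ∀ i : Fin n, 0 < (Q.rnDeriv P (x i)).toReal := by
    rw [ae_all_iff]
    intro i
    have h1 : ∀ᵐ y ∂Q, 0 < (Q.rnDeriv P y).toReal := by
      filter_upwards [Measure.rnDeriv_pos hac, hac.ae_le (Measure.rnDeriv_ne_top Q P)] with y h1 h2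
      exact ENNReal.toReal_pos h1.ne' h2
    have h2 : ρ.map (Function.eval i) ≪ Q := hQdef ▸ map_eval_absolutelyContinuous_avgMarginal i
    exact ae_of_ae_map (measurable_pi_apply i).aemeasurable (h2.ae_le h1)
  have hQeq : P.withDensity (Q.rnDeriv P) = Q := Measure.withDensity_rnDeriv_eq Q P hac
  have : IsProbabilityMeasure (P.withDensity (Q.rnDeriv P)) := hQeq.symm ▸ hQp
  have hprod : ∫⁻ x, ∏ i, Q.rnDeriv P (x i) ∂(Measure.pi fun _ : Fin n => P) = 1 := by
    have h1 := congrArg (fun m => m Set.univ)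
      (pi_withDensity (n := n) P (Measure.measurable_rnDeriv Q P))
    simpa [withDensity_apply] using h1.symm
  have hYm : Measurable fun x : Fin n → α => ∑ i, llr Q P (x i) :=
    Finset.measurable_sum _ fun i _ => (measurable_llr Q P).comp (measurable_pi_apply i)
  have hexp : ∫⁻ x, ENNReal.ofReal (Real.exp (∑ i, llr Q P (x i))) ∂ρ ≤ c := by
    calc ∫⁻ x, ENNReal.ofReal (Real.exp (∑ i, llr Q P (x i))) ∂ρ
        ≤ ∫⁻ x, ∏ i, Q.rnDeriv P (x i) ∂ρ := by
          refine lintegral_mono_ae ?_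
          filter_upwards [hpos] with x hx
          rw [Real.exp_sum, ENNReal.ofReal_prod_of_nonneg fun _ _ => (Real.exp_pos _).le]
          refine Finset.prod_le_prod' fun i _ => ?_
          rw [llr, Real.exp_log (hx i)]
          exact ENNReal.ofReal_toReal_le
      _ ≤ ∫⁻ x, ∏ i, Q.rnDeriv P (x i) ∂(c • Measure.pi fun _ : Fin n => P) :=
          lintegral_mono' hρ le_rfl
      _ = c := by rw [lintegral_smul_measure, hprod, smul_eq_mul, mul_one]
  have hYint : Integrable (fun x => ∑ i, llr Q P (x i)) ρ := integrable_finsetSum _ fun i _ => hinti i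
  have hexpint : Integrable (fun x => Real.exp (∑ i, llr Q P (x i))) ρ := by
    refine (lintegral_ofReal_ne_top_iff_integrable hYm.exp.aestronglyMeasurable
      (ae_of_all _ fun _ => (Real.exp_pos _).le)).1 (ne_top_of_le_ne_top hc hexp)
  have hexple : ∫ x, Real.exp (∑ i, llr Q P (x i)) ∂ρ ≤ c.toReal := by
    rw [integral_eq_lintegral_of_nonneg_ae (ae_of_all _ fun _ => (Real.exp_pos _).le)
      hYm.exp.aestronglyMeasurable]
    exact ENNReal.toReal_mono hc hexp
  -- Jensen's inequality for the logarithm, through `t + 1 ≤ e^t` at `t = ∑ llr - log c`.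
  have key : ∫ x, (∑ i, llr Q P (x i) + (1 - Real.log c.toReal)) ∂ρ ≤
      ∫ x, c.toReal⁻¹ * Real.exp (∑ i, llr Q P (x i)) ∂ρ := by
    refine integral_mono (hYint.add (integrable_const _)) (hexpint.const_mul _) fun x => ?_
    have := Real.add_one_le_exp (∑ i, llr Q P (x i) - Real.log c.toReal)
    rw [Real.exp_sub, Real.exp_log hcpos, div_eq_inv_mul] at this
    simp only
    linarith
  rw [integral_add hYint (integrable_const _), integral_const, integral_const_mul] at key
  have h2 : c.toReal⁻¹ * ∫ x, Real.exp (∑ i, llr Q P (x i)) ∂ρ ≤ 1 := by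
    rw [inv_mul_le_iff₀ hcpos, mul_one]
    exact hexple
  simp only [probReal_univ, smul_eq_mul, one_mul] at key
  linarith

end

/-- The nonasymptotic Sanov-type upper bound, in the form of a competitor in `entropySet`. -/
lemma exists_mem_entropySet_mul_klDiv_le {P : Measure ℝ} [IsProbabilityMeasure P] {F U : ℝ → ℝ}
    {ε u : ℝ} (hF : Measurable F) (hU : Measurable U) (hF1 : Integrable F P)
    (hU1 : Integrable U P) {n : ℕ} (hn : n ≠ 0)
    (hp : (Measure.pi fun _ : Fin n => P) (prodEvent P F U ε u n) ≠ 0) :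
    ∃ Q ∈ entropySet P F U ε u, InformationTheory.klDiv Q P ≠ ∞ ∧
      n * (InformationTheory.klDiv Q P).toReal ≤
        -Real.log ((Measure.pi fun _ : Fin n => P) (prodEvent P F U ε u n)).toReal := by
  have hA := measurableSet_prodEvent (P := P) (ε := ε) (u := u) hF hU n
  set A := prodEvent P F U ε u n with hAdef
  set p := (Measure.pi fun _ : Fin n => P) A with hpdef
  have hc : p⁻¹ ≠ ∞ := ENNReal.inv_ne_top.2 hp
  let ρ := ProbabilityTheory.cond (Measure.pi fun _ : Fin n => P) A
  have hρp : IsProbabilityMeasure ρ := cond_isProbabilityMeasure hp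
  have hρ : ρ ≤ p⁻¹ • Measure.pi fun _ : Fin n => P := by
    refine Measure.le_iff.2 fun s _ => ?_
    rw [cond_apply hA, Measure.smul_apply, smul_eq_mul]
    gcongr
    exact Set.inter_subset_right
  have hρA : ρ Aᶜ = 0 := by rw [cond_apply hA]; simp
  have hQp := isProbabilityMeasure_avgMarginal (ρ := ρ) hn
  have hQ := avgMarginal_le_smul hn hρ
  have hac : avgMarginal ρ ≪ P :=
    (Measure.absolutelyContinuous_of_le hQ).trans Measure.smul_absolutelyContinuous
  have hn' : (0 : ℝ) < n := by positivity
  have hFi := fun i => integrable_comp_eval hc hρ hF1 i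
  have hUi := fun i => integrable_comp_eval hc hρ hU1 i
  refine ⟨avgMarginal ρ, ⟨hQp, hF1.of_measure_le_smul hc hQ, hU1.of_measure_le_smul hc hQ,
    ?_, ?_⟩, InformationTheory.klDiv_ne_top hac (integrable_llr_of_le_smul hc hQ), ?_⟩
  -- Some point of `A` has a sum at most the mean, so the strict constraint defining `A` passes to
  -- the mean.
  · obtain ⟨x, hx, hle⟩ := exists_notMem_null_le_integral
      (integrable_finsetSum Finset.univ fun i _ => hFi i) hρA
    rw [← mul_integral_avgMarginal hn hF hFi] at hle
    have hx' : x ∈ A := not_not.1 hx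
    have := lt_of_mul_lt_mul_left (hx'.1.trans_le hle) hn'.le
    linarith
  · obtain ⟨x, hx, hle⟩ := exists_notMem_null_integral_le
      (integrable_finsetSum Finset.univ fun i _ => hUi i) hρA
    rw [← mul_integral_avgMarginal hn hU hUi] at hle
    have hx' : x ∈ A := not_not.1 hx
    have := lt_of_mul_lt_mul_left (hle.trans_lt hx'.2) hn'.le
    linarith
  · rw [InformationTheory.toReal_klDiv_of_measure_eq hac (by simp)]
    refine (mul_integral_llr_avgMarginal_le hc hn hρ).trans_eq ?_
    rw [ENNReal.toReal_inv, Real.log_inv]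

/-! ### The Gibbs inequality and the easy half of duality -/

section

variable {P : Measure ℝ} {F U : ℝ → ℝ} {ε u : ℝ}

/-- The infimum lives in `ℝ≥0∞`; a negative bound is trivial and a nonnegative one transfers through
`toENNReal`. -/
lemma le_entropyRate {a : EReal}
    (h : ∀ Q ∈ entropySet P F U ε u, a ≤ (InformationTheory.klDiv Q P : EReal)) :
    a ≤ (entropyRate P F U ε u : EReal) := by
  rcases le_total a 0 with ha | ha
  · exact ha.trans (EReal.coe_ennreal_nonneg _)
  rw [← EReal.coe_toENNReal ha] at h ⊢
  exact EReal.coe_ennreal_le_coe_ennreal_iff.2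
    (le_iInf₂ fun Q hQ => EReal.coe_ennreal_le_coe_ennreal_iff.1 (h Q hQ))

/-- The Gibbs variational inequality. -/
lemma integral_sub_toReal_klDiv_le_log {α : Type*} [MeasurableSpace α] {P Q : Measure α}
    [IsProbabilityMeasure P] [IsProbabilityMeasure Q] {G : α → ℝ} (hGQ : Integrable G Q)
    (hexp : Integrable (fun x => Real.exp (G x)) P) (hkl : InformationTheory.klDiv Q P ≠ ∞) :
    ∫ x, G x ∂Q - (InformationTheory.klDiv Q P).toReal ≤ Real.log (∫ x, Real.exp (G x) ∂P) := by
  obtain ⟨hac, hllr⟩ := InformationTheory.klDiv_ne_top_iff.1 hkl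
  -- The inequality is nonnegativity of the entropy of `Q` relative to `P` tilted by `G`.
  have := isProbabilityMeasure_tilted hexp
  have h0 := InformationTheory.integral_llr_add_sub_measure_univ_nonneg
    (hac.trans (absolutelyContinuous_tilted hexp))
    (integrable_llr_tilted_right hac hGQ hllr hexp)
  rw [integral_llr_tilted_right hac hGQ hexp hllr] at h0
  rw [InformationTheory.toReal_klDiv_of_measure_eq hac (by simp)]
  simp only [probReal_univ] at h0
  linarith

/-- Gibbs with `G = θ₁ F - θ₂ U`; the signs of `θ₁, θ₂` are what let the mean constraints on `Q` be
inserted. -/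
lemma rate_le_entropyRate [IsProbabilityMeasure P] (hF : Measurable F) (hU : Measurable U) :
    rate P F U ε u ≤ (entropyRate P F U ε u : EReal) := by
  refine iSup₂_le fun θ₁ h₁ => iSup₂_le fun θ₂ h₂ => le_entropyRate fun Q hQ => ?_
  obtain ⟨hQp, hFQ, hUQ, hFε, hUu⟩ := hQ
  by_cases hkl : InformationTheory.klDiv Q P = ∞
  · rw [hkl]; exact le_top
  by_cases hΛ : ∫⁻ x, ENNReal.ofReal (Real.exp (θ₁ * F x - θ₂ * U x)) ∂P = ∞
  · rw [logMgf, hΛ, ENNReal.log_top, EReal.sub_top]; exact bot_le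
  have hexp : Integrable (fun x => Real.exp (θ₁ * F x - θ₂ * U x)) P :=
    (lintegral_ofReal_ne_top_iff_integrable (Measurable.aestronglyMeasurable (by fun_prop))
      (ae_of_all _ fun _ => (Real.exp_pos _).le)).1 hΛ
  have hG : Integrable (fun x => θ₁ * F x - θ₂ * U x) Q :=
    (hFQ.const_mul θ₁).sub (hUQ.const_mul θ₂)
  have hgibbs := integral_sub_toReal_klDiv_le_log hG hexp hkl
  rw [integral_sub (hFQ.const_mul θ₁) (hUQ.const_mul θ₂), integral_const_mul,
    integral_const_mul] at hgibbs
  rw [logMgf, ← ofReal_integral_eq_lintegral_ofReal hexp (ae_of_all _ fun _ => (Real.exp_pos _).le),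
    ENNReal.log_ofReal_of_pos (integral_exp_pos hexp), ← EReal.coe_ennreal_toReal hkl,
    ← EReal.coe_sub, EReal.coe_le_coe_iff]
  have e1 : θ₁ * ((∫ x, F x ∂P) + ε) ≤ θ₁ * ∫ x, F x ∂Q :=
    mul_le_mul_of_nonneg_left (by linarith) h₁
  have e2 : θ₂ * ∫ x, U x ∂Q ≤ θ₂ * ((∫ x, U x ∂P) + u) :=
    mul_le_mul_of_nonneg_left (by linarith) h₂
  linarith

end

/-! ### Bounded densities and the log-moment generating function -/

/-- A bounded probability density with respect to `P`. -/
structure IsBoundedDensity {α : Type*} [MeasurableSpace α] (P : Measure α) (g : α → ℝ) : Prop where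
  measurable : Measurable g
  nonneg : ∀ x, 0 ≤ g x
  bounded : ∃ M, ∀ x, g x ≤ M
  integral_eq_one : ∫ x, g x ∂P = 1

namespace IsBoundedDensity

variable {α : Type*} [MeasurableSpace α] {P : Measure α} {g g' : α → ℝ}

lemma integrable_mul (hg : IsBoundedDensity P g) {G : α → ℝ} (hG : Integrable G P) :
    Integrable (fun x => g x * G x) P := by
  obtain ⟨M, hM⟩ := hg.bounded
  refine hG.bdd_mul (c := M) hg.measurable.aestronglyMeasurable (ae_of_all _ fun x => ?_)
  rw [Real.norm_of_nonneg (hg.nonneg x)]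
  exact hM x

lemma integral_convexComb_mul (hg : IsBoundedDensity P g) (hg' : IsBoundedDensity P g')
    {G : α → ℝ} (hG : Integrable G P) (a b : ℝ) :
    ∫ x, (a * g x + b * g' x) * G x ∂P = a * ∫ x, g x * G x ∂P + b * ∫ x, g' x * G x ∂P := by
  simp only [add_mul, mul_assoc]
  rw [integral_add ((hg.integrable_mul hG).const_mul a) ((hg'.integrable_mul hG).const_mul b),
    integral_const_mul, integral_const_mul]

variable [IsProbabilityMeasure P]

lemma integrable (hg : IsBoundedDensity P g) : Integrable g P := by
  simpa using hg.integrable_mul (integrable_const (1 : ℝ))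

lemma integrable_klFun (hg : IsBoundedDensity P g) :
    Integrable (fun x => InformationTheory.klFun (g x)) P := by
  obtain ⟨M, hM⟩ := hg.bounded
  obtain ⟨B, hB⟩ := (isCompact_Icc (a := (0 : ℝ)) (b := M)).exists_bound_of_continuousOn
    InformationTheory.continuous_klFun.continuousOn
  exact Integrable.of_bound
    (InformationTheory.measurable_klFun.comp hg.measurable).aestronglyMeasurable B
    (ae_of_all _ fun x => hB _ ⟨hg.nonneg x, hM x⟩)

lemma one : IsBoundedDensity P fun _ => (1 : ℝ) :=
  ⟨measurable_const, fun _ => zero_le_one, ⟨1, fun _ => le_rfl⟩, by simp⟩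

lemma convexComb (hg : IsBoundedDensity P g) (hg' : IsBoundedDensity P g') {a b : ℝ}
    (ha : 0 ≤ a) (hb : 0 ≤ b) (hab : a + b = 1) :
    IsBoundedDensity P fun x => a * g x + b * g' x := by
  obtain ⟨M, hM⟩ := hg.bounded
  obtain ⟨M', hM'⟩ := hg'.bounded
  refine ⟨(hg.measurable.const_mul a).add (hg'.measurable.const_mul b),
    fun x => add_nonneg (mul_nonneg ha (hg.nonneg x)) (mul_nonneg hb (hg'.nonneg x)),
    ⟨a * M + b * M', fun x => add_le_add (mul_le_mul_of_nonneg_left (hM x) ha)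
      (mul_le_mul_of_nonneg_left (hM' x) hb)⟩, ?_⟩
  rw [integral_add (hg.integrable.const_mul a) (hg'.integrable.const_mul b), integral_const_mul,
    integral_const_mul, hg.integral_eq_one, hg'.integral_eq_one]
  linarith

lemma integral_klFun_convexComb_le (hg : IsBoundedDensity P g) (hg' : IsBoundedDensity P g')
    {a b : ℝ} (ha : 0 ≤ a) (hb : 0 ≤ b) (hab : a + b = 1) :
    ∫ x, InformationTheory.klFun (a * g x + b * g' x) ∂P ≤
      a * ∫ x, InformationTheory.klFun (g x) ∂P +
        b * ∫ x, InformationTheory.klFun (g' x) ∂P := by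
  rw [← integral_const_mul, ← integral_const_mul,
    ← integral_add (hg.integrable_klFun.const_mul a) (hg'.integrable_klFun.const_mul b)]
  refine integral_mono (hg.convexComb hg' ha hb hab).integrable_klFun
    ((hg.integrable_klFun.const_mul a).add (hg'.integrable_klFun.const_mul b)) fun x => ?_
  exact InformationTheory.convexOn_klFun.2 (hg.nonneg x) (hg'.nonneg x) ha hb hab

end IsBoundedDensity

/-- The Donsker–Varadhan formula for the log-moment generating function needs bounded densities
only. -/
lemma lintegral_exp_le_of_forall_isBoundedDensity {α : Type*} [MeasurableSpace α] {P : Measure α}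
    [IsProbabilityMeasure P] {G : α → ℝ} (hG : Measurable G) {c : ℝ}
    (h : ∀ g, IsBoundedDensity P g →
      ∫ x, g x * G x ∂P - ∫ x, InformationTheory.klFun (g x) ∂P ≤ c) :
    ∫⁻ x, ENNReal.ofReal (Real.exp (G x)) ∂P ≤ ENNReal.ofReal (Real.exp c) := by
  -- Truncation to `|G| ≤ k` keeps the Gibbs density bounded; monotone convergence removes it.
  let B : ℕ → Set α := fun k => {x | |G x| ≤ k}
  have hB : ∀ k, MeasurableSet (B k) := fun k => measurableSet_le hG.abs measurable_const
  have hmono : Monotone B := fun i j hij x (hx : |G x| ≤ i) =>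
    hx.trans (by exact_mod_cast hij)
  have hunion : ⋃ k, B k = Set.univ := Set.eq_univ_of_forall fun x =>
    Set.mem_iUnion.2 (exists_nat_ge |G x|)
  rw [← setLIntegral_univ, ← hunion, setLIntegral_iUnion_of_directed _ hmono.directed_le]
  refine iSup_le fun k => ?_
  have hbd : ∀ x ∈ B k, Real.exp (G x) ≤ Real.exp k := fun x hx =>
    Real.exp_le_exp.2 ((le_abs_self _).trans hx)
  have hint : IntegrableOn (fun x => Real.exp (G x)) (B k) P := by
    refine Integrable.of_bound hG.exp.aestronglyMeasurable (Real.exp k) ?_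
    filter_upwards [ae_restrict_mem (hB k)] with x hx
    rw [Real.norm_of_nonneg (Real.exp_pos _).le]
    exact hbd x hx
  rw [← ofReal_integral_eq_lintegral_ofReal hint (ae_of_all _ fun _ => (Real.exp_pos _).le)]
  refine ENNReal.ofReal_le_ofReal ?_
  set Z := ∫ x in B k, Real.exp (G x) ∂P with hZ
  have hZnn : 0 ≤ Z := integral_nonneg fun x => (Real.exp_pos (G x)).le
  rcases hZnn.eq_or_lt with hZ0 | hZ0
  · rw [← hZ0]; exact (Real.exp_pos c).le
  rw [← Real.log_le_iff_le_exp hZ0]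
  -- The optimal density on `B k`: its value in the variational expression is exactly `log Z`.
  let g : α → ℝ := (B k).indicator fun x => Real.exp (G x) / Z
  have hg : IsBoundedDensity P g := by
    refine ⟨(hG.exp.div_const Z).indicator (hB k),
      fun x => Set.indicator_nonneg (fun x _ => (div_pos (Real.exp_pos _) hZ0).le) x,
      ⟨Real.exp k / Z, fun x => Set.indicator_le' (fun x hx => ?_)
        (fun x _ => (div_pos (Real.exp_pos _) hZ0).le) x⟩, ?_⟩
    · exact div_le_div_of_nonneg_right (hbd x hx) hZ0.le
    · rw [integral_indicator (hB k), integral_div, ← hZ, div_self hZ0.ne']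
  have hpt : ∀ x, g x * G x = InformationTheory.klFun (g x) + (g x * (Real.log Z + 1) - 1) := by
    intro x
    rw [InformationTheory.klFun_apply]
    by_cases hx : x ∈ B k
    · have : g x = Real.exp (G x) / Z := Set.indicator_of_mem hx _
      rw [this, Real.log_div (Real.exp_pos _).ne' hZ0.ne', Real.log_exp]
      ring
    · have : g x = 0 := Set.indicator_of_notMem hx _
      rw [this]
      ring
  have hh := h g hg
  have hi2 : Integrable (fun x => g x * (Real.log Z + 1)) P := hg.integrable.mul_const _
  have hgG : ∫ x, g x * G x ∂P = ∫ x, InformationTheory.klFun (g x) ∂P + Real.log Z := by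
    simp only [hpt]
    rw [integral_add (g := fun x => g x * (Real.log Z + 1) - 1) hg.integrable_klFun
      (hi2.sub (integrable_const 1)), integral_sub hi2 (integrable_const 1), integral_mul_const, hg.integral_eq_one]
    simp
  linarith

/-- Large `t` controls the slope and `t → 0` the intercept. This extracts the signs of the
separating functional and removes the slacks. -/
lemma slope_nonpos_of_forall_add_mul_le {x y R : ℝ} (h : ∀ t, 0 < t → x + t * y ≤ R) :
    y ≤ 0 ∧ x ≤ R := by
  constructor
  · by_contra! hy
    have := h ((|R - x| + 1) / y) (by positivity)
    rw [div_mul_cancel₀ _ hy.ne'] at this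
    linarith [le_abs_self (R - x)]
  · have hlim : Tendsto (fun t : ℝ => x + t * y) (𝓝[>] 0) (𝓝 x) := by
      have : Continuous fun t : ℝ => x + t * y := by fun_prop
      simpa using (this.tendsto 0).mono_left nhdsWithin_le_nhds
    exact le_of_tendsto hlim (by filter_upwards [self_mem_nhdsWithin] with t ht using h t ht)

/-! ### Separation and the hard half of duality -/

/-- Triples `(a, b, h)` for which some bounded density of entropy below `h` has `F`-mean excess
above `a` and `U`-mean excess below `b`. -/
def entropyEpigraph (P : Measure ℝ) (F U : ℝ → ℝ) : Set (ℝ × ℝ × ℝ) :=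
  ⋃ g ∈ {g | IsBoundedDensity P g},
    Set.Iio (∫ x, g x * F x ∂P - ∫ x, F x ∂P) ×ˢ
      Set.Ioi (∫ x, g x * U x ∂P - ∫ x, U x ∂P) ×ˢ
        Set.Ioi (∫ x, InformationTheory.klFun (g x) ∂P)

lemma isOpen_entropyEpigraph {P : Measure ℝ} {F U : ℝ → ℝ} : IsOpen (entropyEpigraph P F U) :=
  isOpen_biUnion fun _ _ => isOpen_Iio.prod (isOpen_Ioi.prod isOpen_Ioi)

section

variable {P : Measure ℝ} [IsProbabilityMeasure P] {F U : ℝ → ℝ} {ε u : ℝ}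

lemma entropyRate_le_of_isBoundedDensity (hF1 : Integrable F P) (hU1 : Integrable U P)
    {g : ℝ → ℝ} (hg : IsBoundedDensity P g) (hFε : ε < ∫ x, g x * F x ∂P - ∫ x, F x ∂P)
    (hUu : ∫ x, g x * U x ∂P - ∫ x, U x ∂P < u) :
    entropyRate P F U ε u ≤ ENNReal.ofReal (∫ x, InformationTheory.klFun (g x) ∂P) := by
  have hgm : Measurable fun x => ENNReal.ofReal (g x) := hg.measurable.ennreal_ofReal
  let Q := P.withDensity fun x => ENNReal.ofReal (g x)
  have hint : ∀ {G : ℝ → ℝ}, Integrable G P → Integrable G Q ∧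
      ∫ x, G x ∂Q = ∫ x, g x * G x ∂P := by
    intro G hG
    have ht : ∀ x, (ENNReal.ofReal (g x)).toReal = g x := fun x =>
      ENNReal.toReal_ofReal (hg.nonneg x)
    constructor
    · rw [integrable_withDensity_iff_integrable_smul' hgm (by simp)]
      simpa only [ht, smul_eq_mul] using hg.integrable_mul hG
    · rw [integral_withDensity_eq_integral_toReal_smul hgm (by simp)]
      simp only [ht, smul_eq_mul]
  have hQp : IsProbabilityMeasure Q := by
    constructor
    rw [withDensity_apply _ MeasurableSet.univ, setLIntegral_univ,
      ← ofReal_integral_eq_lintegral_ofReal hg.integrable (ae_of_all _ hg.nonneg),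
      hg.integral_eq_one, ENNReal.ofReal_one]
  have hQE : Q ∈ entropySet P F U ε u := by
    refine ⟨hQp, (hint hF1).1, (hint hU1).1, ?_, ?_⟩
    · rwa [(hint hF1).2]
    · rwa [(hint hU1).2]
  refine (iInf₂_le Q hQE).trans_eq ?_
  rw [InformationTheory.klDiv_eq_lintegral_klFun_of_ac (withDensity_absolutelyContinuous _ _),
    ofReal_integral_eq_lintegral_ofReal hg.integrable_klFun
      (ae_of_all _ fun x => InformationTheory.klFun_nonneg (hg.nonneg x))]
  refine lintegral_congr_ae ?_
  filter_upwards [Measure.rnDeriv_withDensity P hgm] with x hx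
  rw [hx, ENNReal.toReal_ofReal (hg.nonneg x)]

lemma convex_entropyEpigraph (hF1 : Integrable F P) (hU1 : Integrable U P) :
    Convex ℝ (entropyEpigraph P F U) := by
  intro p hp q hq a b ha hb hab
  simp only [entropyEpigraph, Set.mem_iUnion, Set.mem_prod, Set.mem_Iio, Set.mem_Ioi,
    Set.mem_ofPred_eq] at hp hq ⊢
  obtain ⟨g, hg, p1, p2, p3⟩ := hp
  obtain ⟨g', hg', q1, q2, q3⟩ := hq
  -- One weight may vanish, so strictness is taken from whichever weight is positive.
  have key : ∀ {x y x' y' : ℝ}, x < x' → y < y' → a * x + b * y < a * x' + b * y' := by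
    intro x y x' y' hx hy
    rcases ha.eq_or_lt with rfl | ha'
    · have : b = 1 := by linarith
      subst this
      linarith
    · have := mul_lt_mul_of_pos_left hx ha'
      have := mul_le_mul_of_nonneg_left hy.le hb
      linarith
  refine ⟨_, hg.convexComb hg' ha hb hab, ?_, ?_, ?_⟩
  · rw [hg.integral_convexComb_mul hg' hF1]
    have := key p1 q1
    have e : (∫ x, F x ∂P) = a * (∫ x, F x ∂P) + b * ∫ x, F x ∂P := by
      rw [← add_mul, hab, one_mul]
    simp only [Prod.fst_add, Prod.smul_fst, smul_eq_mul]
    linarith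
  · rw [hg.integral_convexComb_mul hg' hU1]
    have := key p2 q2
    have e : (∫ x, U x ∂P) = a * (∫ x, U x ∂P) + b * ∫ x, U x ∂P := by
      rw [← add_mul, hab, one_mul]
    simp only [Prod.snd_add, Prod.fst_add, Prod.smul_snd, Prod.smul_fst, smul_eq_mul]
    linarith
  · have := key p3 q3
    have := hg.integral_klFun_convexComb_le hg' ha hb hab
    simp only [Prod.snd_add, Prod.smul_snd, smul_eq_mul]
    linarith

/-- A bound for all bounded densities that is linear in `(∫ F, ∫ U)` gives a lower bound for the
rate function. -/
lemma le_rate_of_forall_isBoundedDensity (hF : Measurable F) (hU : Measurable U)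
    (hF1 : Integrable F P) (hU1 : Integrable U P) {θ₁ θ₂ : ℝ} (h₁ : 0 ≤ θ₁) (h₂ : 0 ≤ θ₂) {c : ℝ}
    (h : ∀ g, IsBoundedDensity P g →
      θ₁ * (∫ x, g x * F x ∂P - ∫ x, F x ∂P) - θ₂ * (∫ x, g x * U x ∂P - ∫ x, U x ∂P) -
        ∫ x, InformationTheory.klFun (g x) ∂P ≤ θ₁ * ε - θ₂ * u - c) :
    (c : EReal) ≤ rate P F U ε u := by
  -- The value of `Λ₊(θ₁, θ₂)` at which the term of the supremum equals `c`.
  set y : ℝ := θ₁ * ((∫ x, F x ∂P) + ε) - θ₂ * ((∫ x, U x ∂P) + u) - c with hy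
  have hL : logMgf P F U θ₁ θ₂ ≤ (y : EReal) := by
    rw [logMgf, ← Real.log_exp y, ← ENNReal.log_ofReal_of_pos (Real.exp_pos y)]
    refine ENNReal.log_le_log (lintegral_exp_le_of_forall_isBoundedDensity (by fun_prop) ?_)
    intro g hg
    have e : ∫ x, g x * (θ₁ * F x - θ₂ * U x) ∂P =
        θ₁ * ∫ x, g x * F x ∂P - θ₂ * ∫ x, g x * U x ∂P := by
      rw [← integral_const_mul, ← integral_const_mul,
        ← integral_sub ((hg.integrable_mul hF1).const_mul _) ((hg.integrable_mul hU1).const_mul _)]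
      exact integral_congr_ae (ae_of_all _ fun x => by ring)
    rw [e]
    linarith [h g hg]
  calc (c : EReal)
      = ((θ₁ * ((∫ x, F x ∂P) + ε) - θ₂ * ((∫ x, U x ∂P) + u) : ℝ) : EReal) - (y : EReal) := by
        rw [← EReal.coe_sub, hy]
        congr 1
        ring
    _ ≤ ((θ₁ * ((∫ x, F x ∂P) + ε) - θ₂ * ((∫ x, U x ∂P) + u) : ℝ) : EReal) -
          logMgf P F U θ₁ θ₂ := EReal.sub_le_sub le_rfl hL
    _ ≤ rate P F U ε u := le_iSup₂_of_le θ₁ h₁ (le_iSup₂_of_le θ₂ h₂ le_rfl)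

/-- The assumed inequality carries no entropy term, so `(θ₁, θ₂)` may be scaled by any `k > 0`. The
shift by `δ` then gains `k δ (θ₁ + θ₂)`, which is unbounded. -/
lemma rate_eq_top_of_forall_isBoundedDensity (hF : Measurable F) (hU : Measurable U)
    (hF1 : Integrable F P) (hU1 : Integrable U P) {θ₁ θ₂ : ℝ} (h₁ : 0 ≤ θ₁) (h₂ : 0 ≤ θ₂)
    (hθ : 0 < θ₁ + θ₂) {δ : ℝ} (hδ : 0 < δ)
    (h : ∀ g, IsBoundedDensity P g →
      θ₁ * (∫ x, g x * F x ∂P - ∫ x, F x ∂P) - θ₂ * (∫ x, g x * U x ∂P - ∫ x, U x ∂P) ≤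
        θ₁ * ε - θ₂ * u) :
    rate P F U (ε + δ) (u - δ) = ⊤ := by
  refine EReal.eq_top_iff_forall_lt _ |>.2 fun y => ?_
  have hd : 0 < δ * (θ₁ + θ₂) := mul_pos hδ hθ
  set k : ℝ := (|y| + 1) / (δ * (θ₁ + θ₂)) with hk
  have hk0 : 0 < k := by positivity
  refine lt_of_lt_of_le ?_ (le_rate_of_forall_isBoundedDensity (c := |y| + 1) hF hU hF1 hU1
    (mul_nonneg hk0.le h₁) (mul_nonneg hk0.le h₂) fun g hg => ?_)
  · exact EReal.coe_lt_coe_iff.2 (by linarith [le_abs_self y])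
  · have e1 := mul_le_mul_of_nonneg_left (h g hg) hk0.le
    have e2 : k * (δ * (θ₁ + θ₂)) = |y| + 1 := div_mul_cancel₀ _ hd.ne'
    have e3 : 0 ≤ ∫ x, InformationTheory.klFun (g x) ∂P :=
      integral_nonneg fun x => InformationTheory.klFun_nonneg (hg.nonneg x)
    linear_combination e1 + e3 - e2

lemma coe_le_rate_of_lt_entropyRate (hF : Measurable F) (hU : Measurable U)
    (hF1 : Integrable F P) (hU1 : Integrable U P)
    (hint : (ε, u) ∈ interior (rateDomain P F U)) {c : ℝ}
    (hc : (c : EReal) < (entropyRate P F U ε u : EReal)) : (c : EReal) ≤ rate P F U ε u := by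
  have hnot : (ε, u, c) ∉ entropyEpigraph P F U := by
    intro hmem
    simp only [entropyEpigraph, Set.mem_iUnion, Set.mem_prod, Set.mem_Iio, Set.mem_Ioi,
      Set.mem_ofPred_eq] at hmem
    obtain ⟨g, hg, p1, p2, p3⟩ := hmem
    have h1 := EReal.coe_ennreal_le_coe_ennreal_iff.2
      (entropyRate_le_of_isBoundedDensity hF1 hU1 hg p1 p2)
    rw [EReal.coe_ennreal_ofReal, max_eq_left (integral_nonneg fun x =>
      InformationTheory.klFun_nonneg (hg.nonneg x))] at h1
    exact absurd (hc.trans_le h1) (not_lt.2 (EReal.coe_le_coe_iff.2 p3.le))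
  obtain ⟨f, hf⟩ := geometric_hahn_banach_open_point (convex_entropyEpigraph hF1 hU1)
    isOpen_entropyEpigraph hnot
  set A := f (1, 0, 0)
  set B := f (0, 1, 0)
  set C := f (0, 0, 1)
  have hfeq : ∀ a b h : ℝ, f (a, b, h) = a * A + b * B + h * C := by
    intro a b h
    have : ((a, b, h) : ℝ × ℝ × ℝ) = a • (1, 0, 0) + b • (0, 1, 0) + h • (0, 0, 1) := by
      simp
    rw [this, map_add, map_add, map_smul, map_smul, map_smul]
    rfl
  have hsep : ∀ g, IsBoundedDensity P g → ∀ t₁, 0 < t₁ → ∀ t₂, 0 < t₂ → ∀ t₃, 0 < t₃ →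
      (∫ x, g x * F x ∂P - ∫ x, F x ∂P - t₁) * A + (∫ x, g x * U x ∂P - ∫ x, U x ∂P + t₂) * B +
        (∫ x, InformationTheory.klFun (g x) ∂P + t₃) * C < ε * A + u * B + c * C := by
    intro g hg t₁ ht₁ t₂ ht₂ t₃ ht₃
    rw [← hfeq, ← hfeq]
    refine hf _ (Set.mem_biUnion (show g ∈ {g | IsBoundedDensity P g} from hg) ?_)
    simp only [Set.mem_prod, Set.mem_Iio, Set.mem_Ioi]
    exact ⟨by linarith, by linarith, by linarith⟩
  -- The epigraph is unbounded in three directions, which fixes the signs of `A`, `B`, `C`; slacks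
  -- tending to 0 give the closed inequality.
  have hcone : ∀ g, IsBoundedDensity P g → -A ≤ 0 ∧ B ≤ 0 ∧ C ≤ 0 ∧
      (∫ x, g x * F x ∂P - ∫ x, F x ∂P) * A + (∫ x, g x * U x ∂P - ∫ x, U x ∂P) * B +
        (∫ x, InformationTheory.klFun (g x) ∂P) * C ≤ ε * A + u * B + c * C := by
    intro g hg
    set a := ∫ x, g x * F x ∂P - ∫ x, F x ∂P
    set b := ∫ x, g x * U x ∂P - ∫ x, U x ∂P
    set e := ∫ x, InformationTheory.klFun (g x) ∂P
    have s1 : ∀ t₂, 0 < t₂ → ∀ t₃, 0 < t₃ → -A ≤ 0 ∧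
        a * A + (b + t₂) * B + (e + t₃) * C ≤ ε * A + u * B + c * C := fun t₂ ht₂ t₃ ht₃ =>
      slope_nonpos_of_forall_add_mul_le fun t₁ ht₁ => by
        linarith [hsep g hg t₁ ht₁ t₂ ht₂ t₃ ht₃]
    have s2 : ∀ t₃, 0 < t₃ → B ≤ 0 ∧
        a * A + b * B + (e + t₃) * C ≤ ε * A + u * B + c * C := fun t₃ ht₃ =>
      slope_nonpos_of_forall_add_mul_le fun t₂ ht₂ => by linarith [(s1 t₂ ht₂ t₃ ht₃).2]
    have s3 : C ≤ 0 ∧ a * A + b * B + e * C ≤ ε * A + u * B + c * C :=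
      slope_nonpos_of_forall_add_mul_le fun t₃ ht₃ => by linarith [(s2 t₃ ht₃).2]
    exact ⟨(s1 1 one_pos 1 one_pos).1, (s2 1 one_pos).1, s3⟩
  obtain ⟨hA, hB, hC, -⟩ := hcone _ IsBoundedDensity.one
  have hA' : 0 ≤ A := by linarith
  have hB' : 0 ≤ -B := by linarith
  -- For `C < 0`, normalizing the entropy coefficient to `-1` gives `θ₁ = A / (-C)` and `θ₂ = -B /
  -- (-C)`.
  rcases hC.lt_or_eq with hC' | hC'
  · have hl : 0 < -C := by linarith
    refine le_rate_of_forall_isBoundedDensity hF hU hF1 hU1 (div_nonneg hA' hl.le)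
      (div_nonneg hB' hl.le) fun g hg => ?_
    have hle := (hcone g hg).2.2.2
    rw [← mul_le_mul_iff_of_pos_left hl]
    have e1 : -C * (A / -C) = A := mul_div_cancel₀ _ hl.ne'
    have e2 : -C * (-B / -C) = -B := mul_div_cancel₀ _ hl.ne'
    simp only [mul_sub, ← mul_assoc, e1, e2]
    linarith
  · exfalso
    -- Otherwise the functional is zero and strict separation reads `0 < 0`.
    have hAB : 0 < A + -B := by
      refine lt_of_le_of_ne (by linarith) fun h0 => ?_
      have hA0 : A = 0 := by linarith
      have hB0 : B = 0 := by linarith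
      have := hsep _ IsBoundedDensity.one 1 one_pos 1 one_pos 1 one_pos
      simp [hA0, hB0, hC'] at this
    -- The shifted points where the rate is infinite tend to `(ε, u)`, an interior point of the
    -- domain.
    have hpath : Tendsto (fun δ : ℝ => (ε + δ, u - δ)) (𝓝[>] 0) (𝓝 (ε, u)) := by
      have : Continuous fun δ : ℝ => (ε + δ, u - δ) := by fun_prop
      simpa using (this.tendsto 0).mono_left nhdsWithin_le_nhds
    obtain ⟨δ, hδD, hδ⟩ := ((hpath.eventually (mem_interior_iff_mem_nhds.1 hint)).and
      self_mem_nhdsWithin).exists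
    refine (hδD : rate P F U (ε + δ) (u - δ) < ⊤).ne
      (rate_eq_top_of_forall_isBoundedDensity hF hU hF1 hU1 hA' hB' hAB hδ fun g hg => ?_)
    have hle := (hcone g hg).2.2.2
    rw [hC'] at hle
    linarith

lemma entropyRate_le_rate (hF : Measurable F) (hU : Measurable U)
    (hF1 : Integrable F P) (hU1 : Integrable U P)
    (hint : (ε, u) ∈ rateDomain P F U → (ε, u) ∈ interior (rateDomain P F U)) :
    (entropyRate P F U ε u : EReal) ≤ rate P F U ε u := by
  by_cases hD : (ε, u) ∈ rateDomain P F U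
  · exact EReal.ge_of_forall_gt_iff_ge.1 fun c hc =>
      coe_le_rate_of_lt_entropyRate hF hU hF1 hU1 (hint hD) hc
  · rw [not_lt_top_iff.1 (show ¬rate P F U ε u < ⊤ from hD)]
    exact le_top

/-! ### The exponential rate of the product event -/

lemma tendsto_log_prodEvent (hF : Measurable F) (hU : Measurable U)
    (hF1 : Integrable F P) (hU1 : Integrable U P) :
    Tendsto (fun n : ℕ => ((1 / (n : ℝ) : ℝ) : EReal) *
        ENNReal.log ((Measure.pi fun _ : Fin n => P) (prodEvent P F U ε u n)))
      atTop (𝓝 (-(entropyRate P F U ε u : EReal))) := by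
  refine tendsto_order.2 ⟨fun a ha => ?_, fun a ha => ?_⟩
  · have ha' : (entropyRate P F U ε u : EReal) < -a := EReal.lt_neg_comm.1 ha
    obtain ⟨Q, hQ, hQa⟩ : ∃ Q ∈ entropySet P F U ε u,
        (InformationTheory.klDiv Q P : EReal) < -a := by
      by_contra! hcon
      exact absurd (le_entropyRate hcon) (not_le.2 ha')
    obtain ⟨h', hQh', hh'a⟩ := EReal.lt_iff_exists_real_btwn.1 hQa
    -- The gap between `h` and `h'` absorbs the term `log 2 / n` left by the factor `1/2`.
    obtain ⟨h, hQh, hhh'⟩ := EReal.lt_iff_exists_real_btwn.1 hQh'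
    have hhr : h < h' := EReal.coe_lt_coe_iff.1 hhh'
    have hkl : InformationTheory.klDiv Q P ≠ ∞ := fun htop => by
      rw [htop] at hQa
      exact not_top_lt hQa
    rw [← EReal.coe_ennreal_toReal hkl, EReal.coe_lt_coe_iff] at hQh
    have hlog : ∀ᶠ n : ℕ in atTop, Real.log 2 / n < h' - h :=
      (tendsto_const_div_atTop_nhds_zero_nat (Real.log 2)).eventually_lt_const (by linarith)
    filter_upwards [eventually_half_le_exp_mul_prodEvent hF hU hQ hkl hQh, hlog,
      eventually_gt_atTop 0] with n hn hln hn0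
    refine (EReal.lt_neg_comm.1 hh'a).trans ?_
    set p := (Measure.pi fun _ : Fin n => P) (prodEvent P F U ε u n)
    have hn0' : (0 : ℝ) < n := by exact_mod_cast hn0
    have hpt : p ≠ ∞ := measure_ne_top _ _
    have hp0 : p ≠ 0 := fun h0 => by simp [h0] at hn
    have hpp : 0 < p.toReal := ENNReal.toReal_pos hp0 hpt
    have hr : (2 : ℝ)⁻¹ ≤ Real.exp (n * h) * p.toReal := by
      have := ENNReal.toReal_mono (ENNReal.mul_ne_top ENNReal.ofReal_ne_top hpt) hn
      rwa [ENNReal.toReal_mul, ENNReal.toReal_ofReal (Real.exp_pos _).le, ENNReal.toReal_inv,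
        ENNReal.toReal_ofNat] at this
    have hr' := Real.log_le_log (by norm_num) hr
    rw [Real.log_inv, Real.log_mul (Real.exp_pos _).ne' hpp.ne', Real.log_exp] at hr'
    rw [ENNReal.log_pos_real hp0 hpt, ← EReal.coe_mul, ← EReal.coe_neg, EReal.coe_lt_coe_iff,
      one_div_mul_eq_div, lt_div_iff₀ hn0']
    rw [div_lt_iff₀ hn0'] at hln
    linarith
  -- The upper bound holds for each `n ≥ 1`; when `p = 0` the logarithm is `⊥`.
  · filter_upwards [eventually_gt_atTop 0] with n hn0
    refine lt_of_le_of_lt ?_ ha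
    have hn0' : (0 : ℝ) < n := by exact_mod_cast hn0
    set p := (Measure.pi fun _ : Fin n => P) (prodEvent P F U ε u n) with hp
    by_cases hp0 : p = 0
    · rw [hp0, ENNReal.log_zero, EReal.coe_mul_bot_of_pos (by positivity)]
      exact bot_le
    obtain ⟨Q, hQ, hkl, hle⟩ :=
      exists_mem_entropySet_mul_klDiv_le hF hU hF1 hU1 hn0.ne' hp0
    rw [ENNReal.log_pos_real hp0 (measure_ne_top _ _), ← EReal.coe_mul]
    refine EReal.le_neg_of_le_neg ((EReal.coe_ennreal_le_coe_ennreal_iff.2 (iInf₂_le Q hQ)).trans ?_)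
    rw [← EReal.coe_ennreal_toReal hkl, ← EReal.coe_neg, EReal.coe_le_coe_iff, one_div_mul_eq_div,
      ← neg_div, le_div_iff₀ hn0']
    linarith

end

end Screened

theorem theorem2p3 {Ω : Type*} [MeasurableSpace Ω] (Pr : Measure Ω) [IsProbabilityMeasure Pr]
    (P : Measure ℝ) [IsProbabilityMeasure P] (X : ℕ → Ω → ℝ)
    (hlaw : ∀ i, HasLaw (X i) P Pr) (hindep : iIndepFun X Pr)
    (F U : ℝ → ℝ) (hF : Measurable F) (hU : Measurable U)
    (hF1 : Integrable F P) (hU1 : Integrable U P)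
    (hm : ∀ β : ℝ, 0 < β → Screened.essBound P F U β < ⊤)
    (hF2 : Integrable (fun x => F x ^ 2) P) (hU2 : Integrable (fun x => U x ^ 2) P)
    (ε u : ℝ) (hε : 0 < ε) (hu : 0 < u) :
    Tendsto (fun n : ℕ => ((1 / (n : ℝ) : ℝ) : EReal) *
        ENNReal.log (Pr (Screened.errorEvent P F U X ε u n)))
      atTop (𝓝 (-(Screened.entropyRate P F U ε u : EReal))) ∧
    (((ε, u) ∈ Screened.rateDomain P F U → (ε, u) ∈ interior (Screened.rateDomain P F U)) →
      Tendsto (fun n : ℕ => ((1 / (n : ℝ) : ℝ) : EReal) *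
          ENNReal.log (Pr (Screened.errorEvent P F U X ε u n)))
        atTop (𝓝 (-(Screened.rate P F U ε u))) ∧
      Screened.rate P F U ε u = (Screened.entropyRate P F U ε u : EReal)) := by
  have hlim : Tendsto (fun n : ℕ => ((1 / (n : ℝ) : ℝ) : EReal) *
      ENNReal.log (Pr (Screened.errorEvent P F U X ε u n)))
      atTop (𝓝 (-(Screened.entropyRate P F U ε u : EReal))) := by
    simp only [Screened.measure_errorEvent_eq hlaw hindep hF hU]
    exact Screened.tendsto_log_prodEvent hF hU hF1 hU1
  refine ⟨hlim, fun hint => ?_⟩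
  have heq := le_antisymm (Screened.rate_le_entropyRate hF hU)
    (Screened.entropyRate_le_rate hF hU hF1 hU1 hint)
  exact ⟨heq ▸ hlim, heq⟩
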